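/- Let $k=\mathbb F_q$ be a finite field and $Q$ the Kronecker quiver $1\rightrightarrows 2$. Put $$\Lambda=\begin{pmatrix}0&0&-1&0\\0&0&0&-1\\1&0&0&-2\\0&1&2&0\end{pmatrix},\quad \widetilde B=\begin{pmatrix}0&2\\-2&0\\1&0\\0&1\end{pmatrix},\quad \widetilde I-\widetilde R'=\begin{pmatrix}1&-2\\0&1\\-1&0\\0&-1\end{pmatrix}.$$ Let $A$ be a commutative ring with a unit $q^{1/2}\in A$ whose square is $q$ (for instance $A=\mathbb Z[q^{\pm 1/2}]$), and let $\mathcal T_q$ be the quantum torus, i.e. the $A$-algebra with $A$-basis $\{X^{\mathbf e}:\mathbf e\in\mathbb Z^4\}$ and product $X^{\mathbf e}X^{\mathbf f}=q^{\frac12\Lambda(\mathbf e,\mathbf f)}X^{\mathbf e+\mathbf f}$, where $\Lambda(\mathbf e,\mathbf f)=\mathbf e^{t}\Lambda\,\mathbf f$. For a finite-dimensional representation $M$ of $Q$ over $k$ with dimension vector $\underline m$, the quantum cluster character is $$X_M=\sum_{\underline e}|\mathrm{Gr}_{\underline e}M|\,q^{-\frac12\langle\underline e,\,\underline m-\underline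 e\rangle}\,X^{-\widetilde B\underline e-(\widetilde I-\widetilde R')\underline m}\in\mathcal T_q,$$ where $\mathrm{Gr}_{\underline e}M$ is the set of subrepresentations of $M$ of dimension vector $\underline e$ and $\langle\underline e,\underline f\rangle=e_1f_1+e_2f_2-2e_1f_2$ is the Euler form of $Q$. Let $X_\delta=X_L$, where $L$ is any indecomposable representation of $Q$ of dimension vector $(1,1)$, and define $S_n=S_n(X_\delta)$ by $S_0=1$, $S_1=X_\delta$ and $S_{n+1}=S_nS_1-X^{(0,0,1,1)}S_{n-1}$ for $n\ge1$. Let $E$ be an indecomposable representation of $Q$ of dimension vector $(1,1)$, and for $n\ge 1$ let $R(n)$ be the indecomposable regular representation of dimension vector $(n,n)$ in the homogeneous tube with mouth $E$, that is, an indecomposable representation of dimension vector $(n,n)$ having a finite filtration by subrepresentations all of whose factors are isomorphic to $E$. Then for every $n\ge1$ $$S_n(X_\delta)=X_{R(n)}.$$ -/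

import Mathlib

/-! ### The quantum torus -/

/-- The quantum torus attached to an integer form `Λ` on `ℤ^m`, over a commutative ring `A` with a
chosen unit `v` playing the role of `𝔮^{1/2}`: the free `A`-module on the symbols `X^e`, `e ∈ ℤ^m`,
with the twisted product `X^e * X^f = v^{Λ(e,f)} X^{e+f}`. Taking `A = ℤ[q^{±1/2}]` and
`v = q^{1/2}` gives the specialisation of the quantum torus at `𝔮 = q`. -/
def QuantumTorus {m : ℕ} (_Λ : Matrix (Fin m) (Fin m) ℤ) {A : Type*} [CommRing A] (_v : Aˣ) :
    Type _ :=
  (Fin m → ℤ) →₀ A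

namespace QuantumTorus

variable {m : ℕ} {Λ : Matrix (Fin m) (Fin m) ℤ} {A : Type*} [CommRing A] {v : Aˣ}

/-- The value `Λ(e,f) = eᵗ Λ f` of the bilinear form with matrix `Λ`. -/
def form (Λ : Matrix (Fin m) (Fin m) ℤ) (e f : Fin m → ℤ) : ℤ :=
  e ⬝ᵥ Λ.mulVec f

lemma form_add_left (e e' f : Fin m → ℤ) : form Λ (e + e') f = form Λ e f + form Λ e' f := by
  simp [form, add_dotProduct]

lemma form_add_right (e f f' : Fin m → ℤ) : form Λ e (f + f') = form Λ e f + form Λ e f' := by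
  simp [form, Matrix.mulVec_add, dotProduct_add]

lemma form_zero_left (f : Fin m → ℤ) : form Λ 0 f = 0 := by simp [form]

lemma form_zero_right (e : Fin m → ℤ) : form Λ e 0 = 0 := by simp [form]

noncomputable instance : AddCommGroup (QuantumTorus Λ v) :=
  inferInstanceAs (AddCommGroup ((Fin m → ℤ) →₀ A))

noncomputable instance : Module A (QuantumTorus Λ v) :=
  inferInstanceAs (Module A ((Fin m → ℤ) →₀ A))

/-- The element `c X^e`. -/
noncomputable def monomial (Λ : Matrix (Fin m) (Fin m) ℤ) (v : Aˣ) (e : Fin m → ℤ) (c : A) :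
    QuantumTorus Λ v :=
  Finsupp.single e c

/-- The basis element `X^e`. -/
noncomputable def X (Λ : Matrix (Fin m) (Fin m) ℤ) (v : Aˣ) (e : Fin m → ℤ) :
    QuantumTorus Λ v :=
  monomial Λ v e 1

/-- The twisted product on finitely supported functions, extended bilinearly from
`X^e * X^f = v^{Λ(e,f)} X^{e+f}`. -/
noncomputable def twistedMul (Λ : Matrix (Fin m) (Fin m) ℤ) (v : Aˣ)
    (x y : (Fin m → ℤ) →₀ A) : (Fin m → ℤ) →₀ A :=
  x.sum fun e a => y.sum fun f b =>
    Finsupp.single (e + f) (a * b * ((v ^ form Λ e f : Aˣ) : A))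

lemma twistedMul_single (e f : Fin m → ℤ) (a b : A) :
    twistedMul Λ v (Finsupp.single e a) (Finsupp.single f b) =
      Finsupp.single (e + f) (a * b * ((v ^ form Λ e f : Aˣ) : A)) := by
  simp [twistedMul, Finsupp.sum_single_index]

lemma twistedMul_add_left (x y z : (Fin m → ℤ) →₀ A) :
    twistedMul Λ v (x + y) z = twistedMul Λ v x z + twistedMul Λ v y z := by
  refine Finsupp.sum_add_index' (fun e => ?_) fun e a b => ?_
  · simp
  · simp only [add_mul, Finsupp.single_add, Finsupp.sum_add]

lemma twistedMul_add_right (x y z : (Fin m → ℤ) →₀ A) :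
    twistedMul Λ v x (y + z) = twistedMul Λ v x y + twistedMul Λ v x z := by
  simp only [twistedMul]
  rw [← Finsupp.sum_add]
  refine Finsupp.sum_congr fun e _ => ?_
  refine Finsupp.sum_add_index' (fun f => ?_) fun f a b => ?_
  · simp
  · simp only [mul_add, add_mul, Finsupp.single_add]

noncomputable instance : Mul (QuantumTorus Λ v) where
  mul x y := twistedMul Λ v x y

noncomputable instance : One (QuantumTorus Λ v) where
  one := X Λ v 0

lemma one_def : (1 : QuantumTorus Λ v) = monomial Λ v 0 1 := rfl

lemma monomial_mul_monomial (e f : Fin m → ℤ) (a b : A) :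
    monomial Λ v e a * monomial Λ v f b =
      monomial Λ v (e + f) (a * b * ((v ^ form Λ e f : Aˣ) : A)) :=
  twistedMul_single e f a b

protected lemma add_mul' (x y z : QuantumTorus Λ v) : (x + y) * z = x * z + y * z :=
  twistedMul_add_left x y z

protected lemma mul_add' (x y z : QuantumTorus Λ v) : x * (y + z) = x * y + x * z :=
  twistedMul_add_right x y z

protected lemma zero_mul' (x : QuantumTorus Λ v) : 0 * x = 0 := by
  have h := QuantumTorus.add_mul' 0 0 x
  rw [add_zero] at h
  exact left_eq_add.mp h

protected lemma mul_zero' (x : QuantumTorus Λ v) : x * 0 = 0 := by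
  have h := QuantumTorus.mul_add' x 0 0
  rw [add_zero] at h
  exact left_eq_add.mp h

lemma induction {p : QuantumTorus Λ v → Prop} (x : QuantumTorus Λ v) (h0 : p 0)
    (hadd : ∀ x y, p x → p y → p (x + y)) (hmon : ∀ e a, p (monomial Λ v e a)) : p x :=
  Finsupp.induction_linear x h0 (fun f g hf hg => hadd f g hf hg) hmon

protected lemma one_mul' (x : QuantumTorus Λ v) : 1 * x = x := by
  induction x using QuantumTorus.induction with
  | h0 => exact QuantumTorus.mul_zero' _
  | hadd x y hx hy => rw [QuantumTorus.mul_add', hx, hy]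
  | hmon e a => rw [one_def, monomial_mul_monomial]; simp [form_zero_left]

protected lemma mul_one' (x : QuantumTorus Λ v) : x * 1 = x := by
  induction x using QuantumTorus.induction with
  | h0 => exact QuantumTorus.zero_mul' _
  | hadd x y hx hy => rw [QuantumTorus.add_mul', hx, hy]
  | hmon e a => rw [one_def, monomial_mul_monomial]; simp [form_zero_right]

protected lemma mul_assoc' (x y z : QuantumTorus Λ v) : x * y * z = x * (y * z) := by
  induction x using QuantumTorus.induction with
  | h0 => simp only [QuantumTorus.zero_mul']
  | hadd x x' hx hx' => simp only [QuantumTorus.add_mul', hx, hx']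
  | hmon e a =>
    induction y using QuantumTorus.induction with
    | h0 => simp only [QuantumTorus.zero_mul', QuantumTorus.mul_zero']
    | hadd y y' hy hy' => simp only [QuantumTorus.add_mul', QuantumTorus.mul_add', hy, hy']
    | hmon f b =>
      induction z using QuantumTorus.induction with
      | h0 => simp only [QuantumTorus.mul_zero']
      | hadd z z' hz hz' => simp only [QuantumTorus.mul_add', hz, hz']
      | hmon g c =>
        simp only [monomial_mul_monomial, form_add_left, form_add_right, zpow_add,
          Units.val_mul, add_assoc]
        congr 1
        ring

noncomputable instance : Ring (QuantumTorus Λ v) :=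
  { (inferInstance : AddCommGroup (QuantumTorus Λ v)),
    (inferInstance : Mul (QuantumTorus Λ v)),
    (inferInstance : One (QuantumTorus Λ v)) with
    left_distrib := QuantumTorus.mul_add'
    right_distrib := QuantumTorus.add_mul'
    zero_mul := QuantumTorus.zero_mul'
    mul_zero := QuantumTorus.mul_zero'
    mul_assoc := QuantumTorus.mul_assoc'
    one_mul := QuantumTorus.one_mul'
    mul_one := QuantumTorus.mul_one' }

end QuantumTorus

/-! ### Representations of the Kronecker quiver -/

/-- A representation of the Kronecker quiver `1 ⇉ 2` over a field `k`, i.e. a `kQ`-module: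
two vector spaces and two linear maps from the first to the second. -/
structure KroneckerRep.{u, w} (k : Type u) [Field k] where
  V₁ : Type w
  V₂ : Type w
  [acg₁ : AddCommGroup V₁]
  [acg₂ : AddCommGroup V₂]
  [mod₁ : Module k V₁]
  [mod₂ : Module k V₂]
  a : V₁ →ₗ[k] V₂
  b : V₁ →ₗ[k] V₂

namespace KroneckerRep

attribute [instance] acg₁ acg₂ mod₁ mod₂

variable {k : Type*} [Field k]

/-- The dimension vector. -/
noncomputable def dimVec (M : KroneckerRep k) : Fin 2 → ℕ :=
  ![Module.finrank k M.V₁, Module.finrank k M.V₂]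

/-- A subrepresentation: a pair of subspaces stable under both maps. -/
structure Subrep (M : KroneckerRep k) where
  W₁ : Submodule k M.V₁
  W₂ : Submodule k M.V₂
  a_mem : ∀ x ∈ W₁, M.a x ∈ W₂
  b_mem : ∀ x ∈ W₁, M.b x ∈ W₂

/-- The dimension vector of a subrepresentation. -/
noncomputable def Subrep.dimVec {M : KroneckerRep k} (U : M.Subrep) : Fin 2 → ℕ :=
  ![Module.finrank k U.W₁, Module.finrank k U.W₂]

/-- The quiver Grassmannian `Gr_e M` of subrepresentations of `M` with dimension vector `e`. -/
def Gr (M : KroneckerRep k) (e : Fin 2 → ℕ) : Set M.Subrep :=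
  {U | U.dimVec = e}

/-- `M` is indecomposable: it is nonzero and is not the direct sum of two nonzero
subrepresentations. -/
def IsIndecomposable (M : KroneckerRep k) : Prop :=
  (Nontrivial M.V₁ ∨ Nontrivial M.V₂) ∧
    ∀ U W : M.Subrep, IsCompl U.W₁ W.W₁ → IsCompl U.W₂ W.W₂ →
      (U.W₁ = ⊥ ∧ U.W₂ = ⊥) ∨ (W.W₁ = ⊥ ∧ W.W₂ = ⊥)

/-- A morphism of representations. -/
structure Hom (M N : KroneckerRep k) where
  f₁ : M.V₁ →ₗ[k] N.V₁
  f₂ : M.V₂ →ₗ[k] N.V₂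
  comm_a : ∀ x, f₂ (M.a x) = N.a (f₁ x)
  comm_b : ∀ x, f₂ (M.b x) = N.b (f₁ x)

/-- `0 → M' → M → M'' → 0` is a short exact sequence. -/
structure IsShortExact {M' M M'' : KroneckerRep k} (i : Hom M' M) (p : Hom M M'') : Prop where
  inj₁ : Function.Injective i.f₁
  inj₂ : Function.Injective i.f₂
  exact₁ : Function.Exact i.f₁ p.f₁
  exact₂ : Function.Exact i.f₂ p.f₂
  surj₁ : Function.Surjective p.f₁
  surj₂ : Function.Surjective p.f₂

/-- `M` has a finite filtration `0 = M₀ ⊆ M₁ ⊆ ⋯ ⊆ M_l = M` by subrepresentations all of whose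
factors `M_i / M_{i-1}` are isomorphic to `E`. -/
inductive IsFilteredBy (E : KroneckerRep k) : KroneckerRep k → Prop
  | zero (M : KroneckerRep k) (h₁ : Subsingleton M.V₁) (h₂ : Subsingleton M.V₂) :
      IsFilteredBy E M
  | step (M' M : KroneckerRep k) (i : Hom M' M) (p : Hom M E) (h : IsShortExact i p)
      (h' : IsFilteredBy E M') : IsFilteredBy E M

/-- `M` lies in the homogeneous tube with mouth `E`: it is an indecomposable regular
representation, all of whose regular composition factors are isomorphic to `E`. (The regular
composition factors of the objects of a tube are the regular simples at its mouth, which form one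
Auslander-Reiten orbit; the tube is homogeneous when this orbit is a single object `E`.) -/
def IsInHomogeneousTube (E M : KroneckerRep k) : Prop :=
  M.IsIndecomposable ∧ IsFilteredBy E M

/-! ### Kronecker quantum cluster algebra with principal coefficients

The ice quiver has vertices `1, 2` and frozen vertices `3, 4`, two arrows `1 → 2`, one arrow
`3 → 1` and one arrow `4 → 2`. -/

/-- The skew-symmetric form `Λ`. -/
def lam : Matrix (Fin 4) (Fin 4) ℤ :=
  !![0, 0, -1, 0;
     0, 0, 0, -1;
     1, 0, 0, -2;
     0, 1, 2, 0]

/-- `R̃`, whose `(i,j)` entry is `dim Ext¹(S_j, S_i)`, the number of arrows `j → i`. -/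
def matR : Matrix (Fin 4) (Fin 2) ℤ :=
  !![0, 0;
     2, 0;
     0, 0;
     0, 0]

/-- `R̃'`, whose `(i,j)` entry is `dim Ext¹(S_i, S_j)`, the number of arrows `i → j`. -/
def matR' : Matrix (Fin 4) (Fin 2) ℤ :=
  !![0, 2;
     0, 0;
     1, 0;
     0, 1]

/-- The exchange matrix `B̃ = R̃' - R̃`. -/
def matB : Matrix (Fin 4) (Fin 2) ℤ :=
  matR' - matR

/-- `Ĩ`, the left `4 × 2` submatrix of the identity matrix. -/
def matI : Matrix (Fin 4) (Fin 2) ℤ :=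
  !![1, 0;
     0, 1;
     0, 0;
     0, 0]

/-- The Euler form `dim Hom - dim Ext¹` of the Kronecker quiver on dimension vectors. -/
def eulerForm (e f : Fin 2 → ℤ) : ℤ :=
  e 0 * f 0 + e 1 * f 1 - 2 * e 0 * f 1

variable {A : Type*} [CommRing A]

/-- The quantum cluster character
`X_M = ∑_e |Gr_e M| q^{-⟨e, m - e⟩/2} X^{-B̃ e - (Ĩ - R̃') m}`, where `m` is the dimension vector
of `M` and `v = q^{1/2}`. As `Gr_e M` is empty unless `e ≤ m`, the sum runs over `0 ≤ e ≤ m`. -/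
noncomputable def clusterCharacter (v : Aˣ) (M : KroneckerRep k) : QuantumTorus lam v :=
  let d : Fin 2 → ℤ := fun i => (M.dimVec i : ℤ)
  ∑ e ∈ Finset.Icc (0 : Fin 2 → ℕ) M.dimVec,
    let e' : Fin 2 → ℤ := fun i => (e i : ℤ)
    (((M.Gr e).ncard : A) * ((v ^ (-eulerForm e' (d - e')) : Aˣ) : A)) •
      QuantumTorus.X lam v (-(matB.mulVec e') - (matI - matR').mulVec d)

/-- The modified Chebyshev polynomials of the second kind evaluated at `x`:
`S₀ = 1`, `S₁ = x`, `S_{n+1} = S_n S₁ - X^{(0,0,1,1)} S_{n-1}`. -/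
noncomputable def chebyshevS {v : Aˣ} (x : QuantumTorus lam v) : ℕ → QuantumTorus lam v
  | 0 => 1
  | 1 => x
  | n + 2 => chebyshevS x (n + 1) * x - QuantumTorus.X lam v ![0, 0, 1, 1] * chebyshevS x n

end KroneckerRep

/-! Both sides reduce to counts of subspaces for nilpotent Jordan blocks. An indecomposable `E` of
dimension (1,1) has, after a change of basis in the space of arrows, one bijective map and one zero
map. Along a filtration with factors `E` these become a bijection P and a map P ∘ T with T
nilpotent. Indecomposability makes T a single Jordan block, so R(n) is (1, N) with N the shift on kⁿ
(`IsInHomogeneousTube.exists_normalForm`). A change of basis of the arrows does not alter the set of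
subrepresentations, hence the character is a weighted sum over pairs U ≤ W with N U ≤ W
(`clusterCharacter_eq_pairSum`).

The shift on kⁿ⁺¹ is ι ∘ π and the shift on kⁿ is π ∘ ι, where π deletes the first coordinate and ι
appends a zero. Let κ span ker π. Sorting the pairs (U, W) by whether κ lies in U, in W only, or in
neither expresses sums at level n+1 through sums at level n. Write P for the sum over all pairs and
I for the sum over pairs with N injective on U; with e = dim U, f = dim W, P(n+1; ψ) = P(n; ψ(e+1,
f+1)) + I(n+1; ψ), I(n+1; ψ) = P(n; q^e ψ(e, f+1)) + I(n; q^(f-e) ψ). These are `pairSum_eq_add` and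
`injPairSum_eq_add`.

Multiplying a term of the character by the three terms of X_δ produces exactly the three weights
above (`charTerm_mul`), but with the last sum over all pairs. The excess is the sum over pairs with
κ in U, which is the subtracted term X^(0,0,1,1) S_(n-1) (`X_mul_charTerm`). -/

section SubspacePairs

open Module

variable {k : Type*} [Field k]

/-! ### Counting subspaces with prescribed image -/

lemma natCard_fiber_eq [Finite k] {D : Type*} [AddCommGroup D] [Module k D]
    [FiniteDimensional k D] (g : D →ₗ[k] k) {f₀ : D} (hf₀ : g f₀ = 1) :
    Nat.card {f : D // g f = 1} = Nat.card k ^ (finrank k D - 1) := by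
  have hsurj : Function.Surjective g := fun c => ⟨c • f₀, by simp [hf₀]⟩
  have h1 := LinearMap.finrank_range_add_finrank_ker g
  rw [LinearMap.range_eq_top.mpr hsurj, finrank_top, finrank_self] at h1
  let e : {f : D // g f = 1} ≃ LinearMap.ker g :=
    { toFun := fun f => ⟨f.1 - f₀, by rw [LinearMap.mem_ker, map_sub, hf₀, f.2, sub_self]⟩
      invFun := fun f => ⟨f.1 + f₀, by rw [map_add, f.2, hf₀, zero_add]⟩
      left_inv := fun f => by simp
      right_inv := fun f => by simp }
  rw [Nat.card_congr e, natCard_eq_pow_finrank (K := k), ← h1, Nat.add_sub_cancel_left]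

/-- On a finite vector space, the number of functionals vanishing on `Y` and equal to `1` at a
vector `x ∉ Y`. -/
lemma natCard_dual_eq_one_on [Finite k] {V : Type*} [AddCommGroup V] [Module k V]
    [FiniteDimensional k V] (Y : Submodule k V) {x : V} (hx : x ∉ Y) :
    Nat.card {f : Dual k V // f x = 1 ∧ ∀ y ∈ Y, f y = 0} =
      Nat.card k ^ (finrank k V - 1 - finrank k Y) := by
  obtain ⟨f, hfx, hf⟩ := Submodule.exists_le_ker_of_notMem hx
  have hf₀ : (f x)⁻¹ • f ∈ Y.dualAnnihilator := by
    rw [Submodule.mem_dualAnnihilator]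
    intro y hy
    have : f y = 0 := hf hy
    simp [this]
  have h1 := natCard_fiber_eq (k := k) (D := Y.dualAnnihilator)
    ((Dual.eval k V x).domRestrict Y.dualAnnihilator) (f₀ := ⟨(f x)⁻¹ • f, hf₀⟩) (by simp [hfx])
  have h2 := Subspace.finrank_add_finrank_dualAnnihilator_eq Y
  rw [← h2, Nat.sub_right_comm, Nat.add_sub_cancel_left, ← h1]
  refine Nat.card_congr
    { toFun := fun f => ⟨⟨f.1, (Submodule.mem_dualAnnihilator _).2 f.2.2⟩, f.2.1⟩
      invFun := fun f => ⟨f.1.1, f.2, (Submodule.mem_dualAnnihilator _).1 f.1.2⟩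
      left_inv := fun f => rfl
      right_inv := fun f => rfl }

/-- Let `π` be a surjection whose kernel is spanned by `κ`. The number of subspaces not containing
`κ`, containing a given `Y`, and with given image under `π`. -/
lemma natCard_lift [Finite k] {V V' : Type*} [AddCommGroup V] [Module k V] [AddCommGroup V']
    [Module k V'] [FiniteDimensional k V] (π : V →ₗ[k] V') (hπ : Function.Surjective π) {κ : V}
    (hker : LinearMap.ker π = Submodule.span k {κ}) (Y : Submodule k V) (hY : κ ∉ Y)
    (W' : Submodule k V') (hYW : Y.map π ≤ W') :
    Nat.card {W : Submodule k V // W.map π = W' ∧ κ ∉ W ∧ Y ≤ W} =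
      Nat.card k ^ (finrank k W' - finrank k Y) := by
  have hκ0 : κ ≠ 0 := fun h => hY (h ▸ Y.zero_mem)
  have hπκ : π κ = 0 := by
    rw [← LinearMap.mem_ker, hker]; exact Submodule.mem_span_singleton_self κ
  set P := W'.comap π with hP
  have hκP : κ ∈ P := by simp [hP, hπκ]
  have hYP : Y ≤ P := Submodule.map_le_iff_le_comap.mp hYW
  let x : P := ⟨κ, hκP⟩
  let Q : Submodule k P := Y.comap P.subtype
  have hx : x ∉ Q := hY
  have hQ : finrank k Q = finrank k Y :=
    (Submodule.comapSubtypeEquivOfLe hYP).finrank_eq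
  have hPW : finrank k P = finrank k W' + 1 := by
    let g : P →ₗ[k] W' := π.restrict (p := P) (q := W') (fun y hy => hy)
    have hg : Function.Surjective g := by
      rintro ⟨w, hw⟩
      obtain ⟨y, rfl⟩ := hπ w
      exact ⟨⟨y, hw⟩, rfl⟩
    have hk : LinearMap.ker g = Submodule.span k {x} := by
      ext y
      rw [LinearMap.mem_ker, Submodule.mem_span_singleton]
      have h1 : g y = 0 ↔ (y : V) ∈ LinearMap.ker π := by
        rw [LinearMap.mem_ker, Subtype.ext_iff]; rfl
      rw [h1, hker, Submodule.mem_span_singleton]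
      simp [Subtype.ext_iff, x]
    have h1 := LinearMap.finrank_range_add_finrank_ker g
    rw [LinearMap.range_eq_top.mpr hg, finrank_top, hk, finrank_span_singleton] at h1
    · exact h1.symm
    · simpa [x, Subtype.ext_iff] using hκ0
  -- The subspaces sought are the hyperplanes of `P` that avoid κ and contain `Y`. Each is the
  -- kernel of a unique functional on `P` normalised to 1 at κ and vanishing on `Y`, so it suffices
  -- to count functionals.
  have hcard := natCard_dual_eq_one_on Q hx
  rw [hQ, hPW, Nat.add_sub_cancel] at hcard
  rw [← hcard]
  symm
  have hmem : ∀ f : {f : Dual k P // f x = 1 ∧ ∀ y ∈ Q, f y = 0},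
      ((LinearMap.ker f.1).map P.subtype).map π = W' ∧ κ ∉ (LinearMap.ker f.1).map P.subtype ∧
        Y ≤ (LinearMap.ker f.1).map P.subtype := by
    intro f
    refine ⟨?_, ?_, ?_⟩
    · apply le_antisymm
      · rintro _ ⟨_, ⟨y, -, rfl⟩, rfl⟩
        exact y.2
      · intro w hw
        obtain ⟨y, rfl⟩ := hπ w
        refine ⟨y - f.1 ⟨y, hw⟩ • κ, ⟨⟨y, hw⟩ - f.1 ⟨y, hw⟩ • x, ?_, rfl⟩, by simp [hπκ]⟩
        change f.1 _ = 0
        rw [map_sub, map_smul, f.2.1]; simp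
    · rintro ⟨y, hy, hyκ⟩
      have hyx : y = x := Subtype.ext hyκ
      have h0 : f.1 y = 0 := hy
      rw [hyx, f.2.1] at h0
      exact one_ne_zero h0
    · intro y hy
      exact ⟨⟨y, hYP hy⟩, f.2.2 _ hy, rfl⟩
  refine Nat.card_congr (Equiv.ofBijective (fun f => ⟨_, hmem f⟩) ⟨?_, ?_⟩)
  · rintro ⟨f, hf, hf'⟩ ⟨g, hg, hg'⟩ hfg
    have h : LinearMap.ker f = LinearMap.ker g :=
      Submodule.map_injective_of_injective P.injective_subtype (congrArg Subtype.val hfg)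
    refine Subtype.ext (LinearMap.ext fun y => ?_)
    -- The common value 1 at `x` is what lets the kernel determine the functional.
    have h1 : y - f y • x ∈ LinearMap.ker f := by simp [hf]
    rw [h, LinearMap.mem_ker, map_sub, map_smul, hg] at h1
    simpa using (sub_eq_zero.mp h1).symm
  · rintro ⟨W, hW, hκW, hYW'⟩
    have hWP : W ≤ P := Submodule.map_le_iff_le_comap.mp hW.le
    have hxW : x ∉ W.comap P.subtype := hκW
    obtain ⟨f, hfx, hf⟩ := Submodule.exists_le_ker_of_notMem hxW
    refine ⟨⟨(f x)⁻¹ • f, by simp [hfx], fun y hy => ?_⟩, Subtype.ext ?_⟩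
    · have : f y = 0 := hf (hYW' hy)
      simp [this]
    · apply le_antisymm
      · rintro _ ⟨y, hy, rfl⟩
        have hy' : π y ∈ W.map π := hW ▸ y.2
        obtain ⟨w, hw, hwy⟩ := hy'
        have h1 : (y : V) - w ∈ LinearMap.ker π := by simp [hwy]
        rw [hker, Submodule.mem_span_singleton] at h1
        obtain ⟨c, hc⟩ := h1
        have h2 : y = ⟨w, hWP hw⟩ + c • x := Subtype.ext (by simp [x, hc])
        have h3 : f y = 0 := by
          have : (f x)⁻¹ * f y = 0 := hy
          simpa [hfx] using this
        have h4 : f ⟨w, hWP hw⟩ = 0 := hf hw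
        rw [h2, map_add, h4, map_smul, zero_add, smul_eq_mul, mul_eq_zero] at h3
        have hc0 : c = 0 := h3.resolve_right hfx
        change (y : V) ∈ W
        rw [h2, hc0]; simpa using hw
      · intro w hw
        refine ⟨⟨w, hWP hw⟩, ?_, rfl⟩
        have : f ⟨w, hWP hw⟩ = 0 := hf hw
        change (f x)⁻¹ * f _ = 0
        simp [this]

instance finite_submodule {V : Type*} [AddCommGroup V] [Module k V] [Finite V] : Finite (Submodule k V) :=
  Finite.of_injective _ SetLike.coe_injective

/-! ### Stable pairs for ι ∘ π and π ∘ ι -/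

section PairSum

variable {V V' : Type*} [AddCommGroup V] [Module k V] [AddCommGroup V'] [Module k V']
  {π : V →ₗ[k] V'} {ι : V' →ₗ[k] V} {κ : V}

lemma disjoint_ker_iff_notMem (hκ : κ ≠ 0)
    (hker : LinearMap.ker π = Submodule.span k {κ}) (U : Submodule k V) :
    Disjoint U (LinearMap.ker π) ↔ κ ∉ U := by
  rw [hker, Submodule.disjoint_span_singleton' hκ]

lemma comap_map_of_mem (hker : LinearMap.ker π = Submodule.span k {κ}) {U : Submodule k V}
    (hU : κ ∈ U) : (U.map π).comap π = U := by
  rw [Submodule.comap_map_eq, hker, sup_eq_left, Submodule.span_singleton_le_iff_mem]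
  exact hU

lemma finrank_map_of_notMem (hκ : κ ≠ 0)
    (hker : LinearMap.ker π = Submodule.span k {κ}) {U : Submodule k V} (hU : κ ∉ U) :
    finrank k (U.map π) = finrank k U := by
  have hd := (disjoint_ker_iff_notMem hκ hker U).2 hU
  have hinj : Function.Injective (π.domRestrict U) :=
    LinearMap.injective_domRestrict_iff.2 hd
  rw [← LinearMap.range_domRestrict, LinearMap.finrank_range_of_inj hinj]

variable [Finite V] [Finite V'] {G : Type*} [AddCommGroup G]

/-- The pairs of subspaces `U ≤ W` with `T U ≤ W`, i.e. the subrepresentations of the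
representation `(1, T)` of the Kronecker quiver. -/
noncomputable def stablePairs (T : V →ₗ[k] V) : Finset (Submodule k V × Submodule k V) :=
  (Set.toFinite {p : Submodule k V × Submodule k V | p.1 ≤ p.2 ∧ p.1.map T ≤ p.2}).toFinset

lemma mem_stablePairs {T : V →ₗ[k] V} {p : Submodule k V × Submodule k V} :
    p ∈ stablePairs T ↔ p.1 ≤ p.2 ∧ p.1.map T ≤ p.2 := by
  simp [stablePairs]

/-- The sum of `ψ (dim U) (dim W)` over the stable pairs `(U, W)`. -/
noncomputable def pairSum (T : V →ₗ[k] V) (ψ : ℤ → ℤ → G) : G :=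
  ∑ p ∈ stablePairs T, ψ (finrank k p.1) (finrank k p.2)

open Classical in
/-- The sum of `ψ (dim U) (dim W)` over the stable pairs `(U, W)` such that `T` is injective
on `U`. -/
noncomputable def injPairSum (T : V →ₗ[k] V) (ψ : ℤ → ℤ → G) : G :=
  ∑ p ∈ stablePairs T with Disjoint p.1 (LinearMap.ker T), ψ (finrank k p.1) (finrank k p.2)

lemma finrank_comap_of_ker_eq_span (hπ : Function.Surjective π) (hκ : κ ≠ 0)
    (hker : LinearMap.ker π = Submodule.span k {κ}) (U : Submodule k V') :
    finrank k (U.comap π) = finrank k U + 1 := by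
  have h := LinearMap.finrank_range_add_finrank_ker (π.domRestrict (U.comap π))
  have h1 : LinearMap.range (π.domRestrict (U.comap π)) = U := by
    rw [LinearMap.range_domRestrict, Submodule.map_comap_eq_of_surjective hπ]
  have hle : LinearMap.ker π ≤ U.comap π := LinearMap.ker_le_comap π
  have h2 : finrank k (LinearMap.ker (π.domRestrict (U.comap π))) = 1 := by
    rw [LinearMap.ker_domRestrict, (Submodule.comapSubtypeEquivOfLe hle).finrank_eq, hker,
      finrank_span_singleton hκ]
  rw [h1, h2] at h
  exact h.symm

open Classical in
-- If κ lies in U, hence in W, both spaces are full preimages under π. Thus (U, W) ↦ (πU, πW) is a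
-- bijection onto the stable pairs of π ∘ ι, and both dimensions drop by one.
lemma sum_stablePairs_mem (hπ : Function.Surjective π) (hκ : κ ≠ 0)
    (hker : LinearMap.ker π = Submodule.span k {κ}) (ψ : ℤ → ℤ → G) :
    ∑ p ∈ stablePairs (ι ∘ₗ π) with κ ∈ p.1, ψ (finrank k p.1) (finrank k p.2) =
      pairSum (π ∘ₗ ι) fun e f => ψ (e + 1) (f + 1) := by
  have hπκ : π κ = 0 := by
    rw [← LinearMap.mem_ker, hker]; exact Submodule.mem_span_singleton_self κ
  refine Finset.sum_nbij' (fun p => (p.1.map π, p.2.map π)) (fun p => (p.1.comap π, p.2.comap π))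
    ?_ ?_ ?_ ?_ ?_
  · intro p hp
    rw [Finset.mem_filter, mem_stablePairs] at hp
    rw [mem_stablePairs]
    refine ⟨Submodule.map_mono hp.1.1, ?_⟩
    have := Submodule.map_mono (f := π) hp.1.2
    rwa [Submodule.map_comp] at this ⊢
  · intro p hp
    rw [mem_stablePairs] at hp
    rw [Finset.mem_filter, mem_stablePairs]
    refine ⟨⟨Submodule.comap_mono hp.1, ?_⟩, by simp [hπκ]⟩
    rw [Submodule.map_comp, Submodule.map_comap_eq_of_surjective hπ,
      ← Submodule.map_le_iff_le_comap, ← Submodule.map_comp]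
    exact hp.2
  · intro p hp
    rw [Finset.mem_filter, mem_stablePairs] at hp
    exact Prod.ext (comap_map_of_mem hker hp.2) (comap_map_of_mem hker (hp.1.1 hp.2))
  · intro p _
    exact Prod.ext (Submodule.map_comap_eq_of_surjective hπ _)
      (Submodule.map_comap_eq_of_surjective hπ _)
  · intro p hp
    rw [Finset.mem_filter, mem_stablePairs] at hp
    have h1 := finrank_comap_of_ker_eq_span hπ hκ hker (p.1.map π)
    have h2 := finrank_comap_of_ker_eq_span hπ hκ hker (p.2.map π)
    rw [comap_map_of_mem hker hp.2] at h1
    rw [comap_map_of_mem hker (hp.1.1 hp.2)] at h2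
    simp only [h1, h2, Nat.cast_add, Nat.cast_one]

/-- As ι is injective, ι ∘ π has kernel spanned by κ, so the pairs with κ outside U are those on
which ι ∘ π is injective. The weight ψ is kept arbitrary because the recursions shift and rescale
it. -/
lemma pairSum_eq_add (hπ : Function.Surjective π) (hι : Function.Injective ι) (hκ : κ ≠ 0)
    (hker : LinearMap.ker π = Submodule.span k {κ}) (ψ : ℤ → ℤ → G) :
    pairSum (ι ∘ₗ π) ψ =
      (pairSum (π ∘ₗ ι) fun e f => ψ (e + 1) (f + 1)) + injPairSum (ι ∘ₗ π) ψ := by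
  classical
  rw [← sum_stablePairs_mem hπ hκ hker, pairSum, injPairSum,
    ← Finset.sum_filter_add_sum_filter_not _ (fun p => κ ∈ p.1)]
  congr 1
  refine Finset.sum_congr (Finset.filter_congr fun p _ => ?_) fun _ _ => rfl
  rw [LinearMap.ker_comp_of_ker_eq_bot _ (LinearMap.ker_eq_bot.mpr hι),
    disjoint_ker_iff_notMem hκ hker]

variable {A : Type*} [CommRing A] [Module A G] [Finite k]

open Classical in
-- Here W is the full preimage of its image, while U is any lift of U' = πU avoiding κ; stability is
-- then automatic. There are q^(dim U') such lifts, by `natCard_lift` with `Y = ⊥`.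
lemma sum_stablePairs_mem_snd (hπ : Function.Surjective π) (hκ : κ ≠ 0)
    (hker : LinearMap.ker π = Submodule.span k {κ}) (v : Aˣ) (hv : (v : A) ^ 2 = (Nat.card k : A))
    (ψ : ℤ → ℤ → G) :
    ∑ p ∈ stablePairs (ι ∘ₗ π) with κ ∉ p.1 ∧ κ ∈ p.2, ψ (finrank k p.1) (finrank k p.2) =
      pairSum (π ∘ₗ ι) fun e f => ((v ^ (2 * e) : Aˣ) : A) • ψ e (f + 1) := by
  have hπκ : π κ = 0 := by
    rw [← LinearMap.mem_ker, hker]; exact Submodule.mem_span_singleton_self κ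
  rw [← Finset.sum_fiberwise_of_maps_to (s := (stablePairs (ι ∘ₗ π)).filter _)
    (t := stablePairs (π ∘ₗ ι)) (g := fun p => (p.1.map π, p.2.map π)), pairSum]
  · refine Finset.sum_congr rfl fun p' hp' => ?_
    rw [Finset.filter_filter]
    rw [mem_stablePairs] at hp'
    rw [Finset.sum_congr rfl (g := fun _ => ψ (finrank k p'.1) (finrank k p'.2 + 1)),
      Finset.sum_const]
    · have hc := natCard_lift π hπ hker ⊥ (by simpa using hκ) p'.1 (by simp)
      rw [finrank_bot, Nat.sub_zero, ← Set.coe_ofPred, Nat.card_coe_set_eq] at hc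
      have : Finset.card {p ∈ stablePairs (ι ∘ₗ π) | (κ ∉ p.1 ∧ κ ∈ p.2) ∧
          (p.1.map π, p.2.map π) = p'} = Nat.card k ^ finrank k p'.1 := by
        rw [← hc, ← Set.ncard_coe_finset]
        refine (Set.ncard_congr (fun U _ => (U, p'.2.comap π)) ?_ ?_ ?_).symm
        · rintro U ⟨hU, hκU, -⟩
          simp only [Finset.coe_filter, Set.mem_ofPred_eq, mem_stablePairs]
          refine ⟨⟨?_, ?_⟩, ⟨hκU, by simp [hπκ]⟩, ?_⟩
          · rw [← Submodule.map_le_iff_le_comap, hU]; exact hp'.1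
          · rw [Submodule.map_comp, hU, ← Submodule.map_le_iff_le_comap, ← Submodule.map_comp]
            exact hp'.2
          · rw [hU, Submodule.map_comap_eq_of_surjective hπ]
        · intro U U' _ _ h
          exact congrArg Prod.fst h
        · rintro p hp
          simp only [Finset.coe_filter, Set.mem_ofPred_eq, mem_stablePairs] at hp
          obtain ⟨-, ⟨h1, h2⟩, rfl⟩ := hp
          exact ⟨p.1, ⟨rfl, h1, bot_le⟩, Prod.ext rfl (comap_map_of_mem hker h2)⟩
      rw [this, ← Nat.cast_smul_eq_nsmul A, Nat.cast_pow, ← hv, ← pow_mul]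
      congr 1
    · intro p hp
      rw [Finset.mem_filter, mem_stablePairs] at hp
      obtain ⟨-, ⟨h1, h2⟩, rfl⟩ := hp
      have h3 := finrank_comap_of_ker_eq_span hπ hκ hker (p.2.map π)
      rw [comap_map_of_mem hker h2] at h3
      simp only [finrank_map_of_notMem hκ hker h1, h3, Nat.cast_add, Nat.cast_one]
  · intro p hp
    rw [Finset.mem_filter, mem_stablePairs] at hp
    rw [mem_stablePairs]
    refine ⟨Submodule.map_mono hp.1.1, ?_⟩
    have := Submodule.map_mono (f := π) hp.1.2
    rwa [Submodule.map_comp] at this ⊢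

open Classical in
-- When κ is outside W, π is injective on W, so W and U' = πU determine U. Stability says that W
-- contains ιU', which forces κ outside ιU', i.e. π ∘ ι injective on U'. For given (U', W') the
-- choices of W are counted by `natCard_lift` with `Y` = ιU', giving q^(dim W' - dim U').
lemma sum_stablePairs_notMem (hπ : Function.Surjective π) (hι : Function.Injective ι) (hκ : κ ≠ 0)
    (hker : LinearMap.ker π = Submodule.span k {κ}) (v : Aˣ) (hv : (v : A) ^ 2 = (Nat.card k : A))
    (ψ : ℤ → ℤ → G) :
    ∑ p ∈ stablePairs (ι ∘ₗ π) with κ ∉ p.2, ψ (finrank k p.1) (finrank k p.2) =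
      injPairSum (π ∘ₗ ι) fun e f => ((v ^ (2 * (f - e)) : Aˣ) : A) • ψ e f := by
  have hdisj : ∀ U : Submodule k V', Disjoint U (LinearMap.ker (π ∘ₗ ι)) ↔ κ ∉ U.map ι := by
    intro U
    rw [LinearMap.ker_comp, ← disjoint_ker_iff_notMem hκ hker, Submodule.disjoint_def,
      Submodule.disjoint_def]
    constructor
    · rintro h _ ⟨x, hx, rfl⟩ hx'
      rw [h x hx hx', map_zero]
    · intro h x hx hx'
      exact hι ((h _ ⟨x, hx, rfl⟩ hx').trans (map_zero ι).symm)
  rw [← Finset.sum_fiberwise_of_maps_to (s := (stablePairs (ι ∘ₗ π)).filter _)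
    (t := (stablePairs (π ∘ₗ ι)).filter fun p => Disjoint p.1 (LinearMap.ker (π ∘ₗ ι)))
    (g := fun p => (p.1.map π, p.2.map π)), injPairSum]
  · refine Finset.sum_congr rfl fun p' hp' => ?_
    rw [Finset.filter_filter]
    rw [Finset.mem_filter, mem_stablePairs, hdisj] at hp'
    obtain ⟨⟨hle, hT⟩, hκp⟩ := hp'
    rw [Finset.sum_congr rfl (g := fun _ => ψ (finrank k p'.1) (finrank k p'.2)),
      Finset.sum_const]
    · have hfr : finrank k (p'.1.map ι) = finrank k p'.1 := 
        (Submodule.equivMapOfInjective ι hι p'.1).finrank_eq.symm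
      have hc := natCard_lift π hπ hker (p'.1.map ι) hκp p'.2
        (by rwa [← Submodule.map_comp])
      rw [hfr, ← Set.coe_ofPred, Nat.card_coe_set_eq] at hc
      have : Finset.card {p ∈ stablePairs (ι ∘ₗ π) | κ ∉ p.2 ∧
          (p.1.map π, p.2.map π) = p'} = Nat.card k ^ (finrank k p'.2 - finrank k p'.1) := by
        rw [← hc, ← Set.ncard_coe_finset]
        -- The only subspace of W with image U' is its intersection with the preimage of U'.
        refine (Set.ncard_congr (fun W _ => (W ⊓ p'.1.comap π, W)) ?_ ?_ ?_).symm
        · rintro W ⟨hW, hκW, hYW⟩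
          have hmap : (W ⊓ p'.1.comap π).map π = p'.1 := by
            rw [← Submodule.map_inf_eq_map_inf_comap, hW, inf_eq_right]
            exact hle
          simp only [Finset.coe_filter, Set.mem_ofPred_eq, mem_stablePairs]
          refine ⟨⟨inf_le_left, ?_⟩, hκW, ?_⟩
          · rw [Submodule.map_comp, hmap]; exact hYW
          · rw [hmap, hW]
        · intro U U' _ _ h
          exact congrArg Prod.snd h
        · rintro p hp
          simp only [Finset.coe_filter, Set.mem_ofPred_eq, mem_stablePairs] at hp
          obtain ⟨⟨h1, h2⟩, h3, rfl⟩ := hp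
          refine ⟨p.2, ⟨rfl, h3, by rwa [← Submodule.map_comp]⟩, Prod.ext ?_ rfl⟩
          apply le_antisymm
          · rintro x ⟨hx2, y, hy, hyx⟩
            have h4 : x - y ∈ LinearMap.ker π := by simp [hyx]
            have h5 := (Submodule.disjoint_def.1 ((disjoint_ker_iff_notMem hκ hker p.2).2 h3))
              _ (p.2.sub_mem hx2 (h1 hy)) h4
            rw [sub_eq_zero.mp h5]; exact hy
          · exact le_inf h1 (Submodule.le_comap_map π p.1)
      -- Needed so that the truncated subtraction in the count agrees with the integer exponent.
      have hfle : finrank k p'.1 ≤ finrank k p'.2 := Submodule.finrank_mono hle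
      rw [this, ← Nat.cast_smul_eq_nsmul A, Nat.cast_pow, ← hv, ← pow_mul]
      congr 1
      rw [← Nat.cast_sub hfle]
      exact mod_cast rfl
    · intro p hp
      rw [Finset.mem_filter, mem_stablePairs] at hp
      obtain ⟨⟨h1, h2⟩, h3, rfl⟩ := hp
      simp only [finrank_map_of_notMem hκ hker h3,
        finrank_map_of_notMem hκ hker (fun h => h3 (h1 h))]
  · intro p hp
    rw [Finset.mem_filter, mem_stablePairs] at hp
    rw [Finset.mem_filter, mem_stablePairs, hdisj]
    refine ⟨⟨Submodule.map_mono hp.1.1, ?_⟩, ?_⟩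
    · have := Submodule.map_mono (f := π) hp.1.2
      rwa [Submodule.map_comp] at this ⊢
    · rw [← Submodule.map_comp]
      exact fun h => hp.2 (hp.1.2 h)

lemma injPairSum_eq_add (hπ : Function.Surjective π) (hι : Function.Injective ι) (hκ : κ ≠ 0)
    (hker : LinearMap.ker π = Submodule.span k {κ}) (v : Aˣ) (hv : (v : A) ^ 2 = (Nat.card k : A))
    (ψ : ℤ → ℤ → G) :
    injPairSum (ι ∘ₗ π) ψ =
      (pairSum (π ∘ₗ ι) fun e f => ((v ^ (2 * e) : Aˣ) : A) • ψ e (f + 1)) +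
      injPairSum (π ∘ₗ ι) fun e f => ((v ^ (2 * (f - e)) : Aˣ) : A) • ψ e f := by
  classical
  rw [← sum_stablePairs_mem_snd hπ hκ hker v hv, ← sum_stablePairs_notMem hπ hι hκ hker v hv,
    injPairSum, ← Finset.sum_filter_add_sum_filter_not _ (fun p => κ ∈ p.2),
    Finset.filter_filter, Finset.filter_filter]
  have hiff : ∀ p : Submodule k V × Submodule k V,
      Disjoint p.1 (LinearMap.ker (ι ∘ₗ π)) ↔ κ ∉ p.1 := fun p => by
    rw [LinearMap.ker_comp_of_ker_eq_bot _ (LinearMap.ker_eq_bot.mpr hι),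
      disjoint_ker_iff_notMem hκ hker]
  congr 1
  · refine Finset.sum_congr (Finset.filter_congr fun p _ => ?_) fun _ _ => rfl
    rw [hiff]
  · refine Finset.sum_congr (Finset.filter_congr fun p hp => ?_) fun _ _ => rfl
    rw [hiff]
    rw [mem_stablePairs] at hp
    exact ⟨fun h => h.2, fun h => ⟨fun h' => h (hp.1 h'), h⟩⟩

end PairSum

end SubspacePairs

/-! ### The nilpotent shift and single Jordan blocks -/

section Shift

open Module

variable (k : Type*) [Field k]

/-- Deleting the first coordinate. -/
def tailMap (n : ℕ) : (Fin (n + 1) → k) →ₗ[k] (Fin n → k) :=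
  LinearMap.funLeft k k Fin.succ

/-- Appending a last coordinate `0`. -/
def padMap (n : ℕ) : (Fin n → k) →ₗ[k] (Fin (n + 1) → k) where
  toFun x i := if h : (i : ℕ) < n then x ⟨i, h⟩ else 0
  map_add' x y := by ext i; by_cases h : (i : ℕ) < n <;> simp [h]
  map_smul' c x := by ext i; by_cases h : (i : ℕ) < n <;> simp [h]

/-- The nilpotent shift `(x₀, …, x_{n-1}) ↦ (x₁, …, x_{n-1}, 0)`. -/
def shift (n : ℕ) : (Fin n → k) →ₗ[k] (Fin n → k) :=
  tailMap k n ∘ₗ padMap k n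

variable {k}

lemma shift_apply {n : ℕ} (x : Fin n → k) (i : Fin n) :
    shift k n x i = if h : (i : ℕ) + 1 < n then x ⟨i + 1, h⟩ else 0 :=
  rfl

variable (k) in
lemma shift_succ (n : ℕ) : shift k (n + 1) = padMap k n ∘ₗ tailMap k n := by
  ext x i
  by_cases h : (i : ℕ) < n <;>
    simp [shift, padMap, tailMap, LinearMap.funLeft_apply, h]

lemma tailMap_surjective (n : ℕ) : Function.Surjective (tailMap k n) :=
  fun x => ⟨Fin.cons 0 x, by ext i; simp [tailMap, LinearMap.funLeft_apply]⟩

lemma padMap_injective (n : ℕ) : Function.Injective (padMap k n) := by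
  intro x y h
  ext i
  have := congrFun h i.castSucc
  simpa [padMap] using this

lemma ker_tailMap (n : ℕ) :
    LinearMap.ker (tailMap k n) = Submodule.span k {(Pi.single 0 1 : Fin (n + 1) → k)} := by
  ext x
  rw [LinearMap.mem_ker, Submodule.mem_span_singleton]
  constructor
  · intro h
    refine ⟨x 0, funext fun i => ?_⟩
    refine Fin.cases (by simp) (fun j => ?_) i
    have := congrFun h j
    simpa [tailMap, LinearMap.funLeft_apply] using this.symm
  · rintro ⟨c, rfl⟩
    ext i
    simp [tailMap, LinearMap.funLeft_apply]

/-- A nilpotent endomorphism without nontrivial invariant decomposition is a single Jordan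
block. -/
theorem exists_equiv_shift_of_isNilpotent {V : Type*} [AddCommGroup V] [Module k V]
    [FiniteDimensional k V] [Nontrivial V] {n : ℕ} (hn : finrank k V = n) (T : V →ₗ[k] V)
    (hT : IsNilpotent T)
    (hind : ∀ U W : Submodule k V, IsCompl U W → U ≤ U.comap T → W ≤ W.comap T →
      U = ⊥ ∨ W = ⊥) :
    ∃ φ : V ≃ₗ[k] (Fin n → k), ∀ x, φ (T x) = shift k n (φ x) := by
  obtain ⟨m, hm, v, hv⟩ : ∃ m, T ^ (m + 1) = 0 ∧ ∃ v, (T ^ m) v ≠ 0 := by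
    refine ⟨nilpotencyClass T - 1, ?_, ?_⟩
    · have h0 : 0 < nilpotencyClass T := pos_nilpotencyClass_iff.mpr hT
      rw [Nat.sub_add_cancel h0]
      exact pow_nilpotencyClass hT
    · have h := pow_pred_nilpotencyClass hT
      by_contra! h'
      exact h (LinearMap.ext h')
  have hpow : ∀ j, m < j → T ^ j = 0 := fun j hj => pow_eq_zero_of_le hj hm
  obtain ⟨f, hf, -⟩ := Submodule.exists_le_ker_of_notMem (p := (⊥ : Submodule k V))
    (show (T ^ m) v ∉ ⊥ by simpa using hv)
  -- Φ and σ split off the Jordan block generated by `v`: the matrix of Φ ∘ σ has entries f(T^(i+j)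
  -- v), which vanish for i + j > m and equal the nonzero f(T^m v) for i + j = m, so it is
  -- antitriangular and invertible.
  let Φ : V →ₗ[k] (Fin (m + 1) → k) := LinearMap.pi fun i => f ∘ₗ T ^ (i : ℕ)
  have hΦ : ∀ x i, Φ x i = f ((T ^ (i : ℕ)) x) := fun x i => rfl
  let σ : (Fin (m + 1) → k) →ₗ[k] V := Fintype.linearCombination k fun i => (T ^ (i : ℕ)) v
  have hσ : ∀ c, σ c = ∑ i, c i • (T ^ (i : ℕ)) v := fun c => Fintype.linearCombination_apply ..
  have hinj : Function.Injective (Φ ∘ₗ σ) := by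
    rw [← LinearMap.ker_eq_bot, LinearMap.ker_eq_bot']
    intro c hc
    have key : ∀ i : ℕ, ∀ hi : i < m + 1, c ⟨i, hi⟩ = 0 := by
      intro i
      induction i using Nat.strong_induction_on with
      | _ i ih =>
        intro hi
        -- In this coordinate the terms with j > i die by nilpotency and those with j < i by
        -- induction, leaving c_i f(T^m v).
        have h1 : f ((T ^ (m - i)) (σ c)) = 0 := congrFun hc ⟨m - i, by omega⟩
        rw [hσ, map_sum, map_sum, Finset.sum_eq_single (⟨i, hi⟩ : Fin (m + 1))] at h1
        · rw [map_smul, map_smul, ← Module.End.mul_apply, ← pow_add,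
            Nat.sub_add_cancel (by omega), smul_eq_mul] at h1
          exact (mul_eq_zero.mp h1).resolve_right hf
        · intro j _ hj
          rcases lt_or_gt_of_ne (fun h => hj (Fin.ext h) : (j : ℕ) ≠ i) with h | h
          · rw [show c j = 0 from ih j h j.2]; simp
          · rw [map_smul, ← Module.End.mul_apply, ← pow_add, hpow _ (by omega)]; simp
        · simp
    exact funext fun i => key i i.2
  have hsurj : Function.Surjective (Φ ∘ₗ σ) := LinearMap.injective_iff_surjective.mp hinj
  have hcompl : IsCompl (LinearMap.range σ) (LinearMap.ker Φ) := by
    refine IsCompl.of_eq ?_ ?_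
    · rw [eq_bot_iff]
      rintro _ ⟨⟨c, rfl⟩, hc⟩
      have : c = 0 := hinj (by rw [map_zero]; exact hc)
      simp [this]
    · rw [eq_top_iff]
      intro x _
      obtain ⟨c, hc⟩ := hsurj (Φ x)
      refine Submodule.mem_sup.2 ⟨σ c, ⟨c, rfl⟩, x - σ c, ?_, by abel⟩
      rw [LinearMap.mem_ker, map_sub, sub_eq_zero]
      exact hc.symm
  have hσT : LinearMap.range σ ≤ (LinearMap.range σ).comap T := by
    rintro _ ⟨c, rfl⟩
    rw [Submodule.mem_comap, hσ, map_sum]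
    refine Submodule.sum_mem _ fun i _ => ?_
    rw [map_smul]
    refine Submodule.smul_mem _ _ ?_
    rw [← Module.End.mul_apply, ← pow_succ']
    by_cases hi : (i : ℕ) < m
    · refine ⟨Pi.single ⟨i + 1, by omega⟩ 1, ?_⟩
      simp [σ, Fintype.linearCombination_apply_single]
    · rw [hpow _ (by omega)]; simp
  have hΦT : LinearMap.ker Φ ≤ (LinearMap.ker Φ).comap T := by
    intro x hx
    rw [Submodule.mem_comap, LinearMap.mem_ker]
    ext i
    rw [hΦ, ← Module.End.mul_apply, ← pow_succ]
    by_cases hi : (i : ℕ) < m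
    · exact congrFun hx ⟨i + 1, by omega⟩
    · rw [hpow _ (by omega)]; simp
  -- The range of σ contains `v` ≠ 0, so ker Φ must vanish. Then Φ is an isomorphism, and it carries
  -- T to the shift because its coordinates are f(T^i x).
  rcases hind _ _ hcompl hσT hΦT with h | h
  · exfalso
    have hv0 : v ∈ LinearMap.range σ :=
      ⟨Pi.single 0 1, by simp [σ, Fintype.linearCombination_apply_single]⟩
    rw [h, Submodule.mem_bot] at hv0
    exact hv (by rw [hv0, map_zero])
  · let φ := LinearEquiv.ofBijective Φ
      ⟨LinearMap.ker_eq_bot.mp h, fun y => (hsurj y).imp' σ fun _ h => h⟩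
    have hmn : m + 1 = n := by rw [← hn, φ.finrank_eq, finrank_fin_fun]
    subst hmn
    refine ⟨φ, fun x => funext fun i => ?_⟩
    rw [shift_apply]
    change f ((T ^ (i : ℕ)) (T x)) = _
    rw [← Module.End.mul_apply, ← pow_succ]
    split_ifs with hi
    · rfl
    · rw [hpow _ (by omega)]; simp

end Shift

/-! ### Normal form of representations in a homogeneous tube -/

namespace KroneckerRep

open Module

variable {k : Type*} [Field k]

/-- The combination `α a + β b` of the two structure maps. -/
def pencil (M : KroneckerRep k) (α β : k) : M.V₁ →ₗ[k] M.V₂ :=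
  α • M.a + β • M.b

lemma pencil_apply (M : KroneckerRep k) (α β : k) (x : M.V₁) :
    M.pencil α β x = α • M.a x + β • M.b x := rfl

lemma Hom.comm_pencil {M N : KroneckerRep k} (f : Hom M N) (α β : k) (x : M.V₁) :
    f.f₂ (M.pencil α β x) = N.pencil α β (f.f₁ x) := by
  simp [pencil_apply, f.comm_a, f.comm_b]

/-- Stability under `a` and `b` is stability under two independent combinations of them. -/
lemma forall_mem_iff_pencil (M : KroneckerRep k) {α β γ δ : k} (hdet : α * δ - β * γ ≠ 0)
    (W₂ : Submodule k M.V₂) (x : M.V₁) :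
    (M.a x ∈ W₂ ∧ M.b x ∈ W₂) ↔ (M.pencil α β x ∈ W₂ ∧ M.pencil γ δ x ∈ W₂) := by
  constructor
  · rintro ⟨ha, hb⟩
    exact ⟨W₂.add_mem (W₂.smul_mem _ ha) (W₂.smul_mem _ hb),
      W₂.add_mem (W₂.smul_mem _ ha) (W₂.smul_mem _ hb)⟩
  · rintro ⟨h1, h2⟩
    constructor
    · rw [← W₂.smul_mem_iff hdet]
      convert W₂.sub_mem (W₂.smul_mem δ h1) (W₂.smul_mem β h2) using 1
      simp only [pencil_apply]
      module
    · rw [← W₂.smul_mem_iff hdet]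
      convert W₂.sub_mem (W₂.smul_mem α h2) (W₂.smul_mem γ h1) using 1
      simp only [pencil_apply]
      module

lemma finrank_V₁ {M : KroneckerRep k} {m n : ℕ} (h : M.dimVec = ![m, n]) :
    finrank k M.V₁ = m := congrFun h 0

lemma finrank_V₂ {M : KroneckerRep k} {m n : ℕ} (h : M.dimVec = ![m, n]) :
    finrank k M.V₂ = n := congrFun h 1

lemma bijective_of_ne_zero {V W : Type*} [AddCommGroup V] [Module k V] [AddCommGroup W]
    [Module k W] (hV : finrank k V = 1) (hW : finrank k W = 1) {f : V →ₗ[k] W} (hf : f ≠ 0) :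
    Function.Bijective f := by
  obtain ⟨x, hx⟩ : ∃ x, f x ≠ 0 := by
    by_contra! h
    exact hf (LinearMap.ext h)
  have hx0 : x ≠ 0 := fun h => hx (by rw [h, map_zero])
  constructor
  · rw [← LinearMap.ker_eq_bot, LinearMap.ker_eq_bot']
    intro y hy
    obtain ⟨c, rfl⟩ := (finrank_eq_one_iff_of_nonzero' x hx0).mp hV y
    rw [map_smul, smul_eq_zero] at hy
    rw [hy.resolve_right hx, zero_smul]
  · intro w
    obtain ⟨c, rfl⟩ := (finrank_eq_one_iff_of_nonzero' _ hx).mp hW w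
    exact ⟨c • x, map_smul ..⟩

/-- An indecomposable of dimension `(1, 1)`, after a change of coordinates in the space of
arrows, is given by an isomorphism and the zero map. -/
lemma IsIndecomposable.exists_pencil {E : KroneckerRep k} (hE : E.IsIndecomposable)
    (hdim : E.dimVec = ![1, 1]) :
    ∃ α β γ δ : k, α * δ - β * γ ≠ 0 ∧ Function.Bijective (E.pencil α β) ∧
      E.pencil γ δ = 0 := by
  have h1 := finrank_V₁ hdim
  have h2 := finrank_V₂ hdim
  have : FiniteDimensional k E.V₁ := FiniteDimensional.of_finrank_pos (by omega)
  have : FiniteDimensional k E.V₂ := FiniteDimensional.of_finrank_pos (by omega)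
  by_cases ha : E.a = 0
  · by_cases hb : E.b = 0
    · exfalso
      have h := hE.2 ⟨⊤, ⊥, by simp [ha], by simp [hb]⟩ ⟨⊥, ⊤, by simp, by simp⟩
        isCompl_top_bot isCompl_bot_top
      have : Nontrivial E.V₁ := nontrivial_of_finrank_pos (R := k) (by omega)
      have : Nontrivial E.V₂ := nontrivial_of_finrank_pos (R := k) (by omega)
      simp at h
    · refine ⟨0, 1, 1, 0, by simp, ?_, by simp [pencil, ha]⟩
      simpa [pencil] using bijective_of_ne_zero h1 h2 hb
  · obtain ⟨c, hc⟩ := (finrank_eq_one_iff_of_nonzero' E.a ha).mp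
      (by rw [finrank_linearMap k k, h1, h2]) E.b
    refine ⟨1, 0, -c, 1, by simp, ?_, by simp [pencil, hc]⟩
    simpa [pencil] using bijective_of_ne_zero h1 h2 ha

/-- In a representation filtered by `E`, if `α a + β b` is invertible and `γ a + δ b` zero on `E`,
then `γ a + δ b` is the composition of the invertible map `α a + β b` and a nilpotent map. -/
lemma IsFilteredBy.exists_nilpotent {E : KroneckerRep k} {α β γ δ : k}
    (hbij : Function.Bijective (E.pencil α β)) (hzero : E.pencil γ δ = 0) {M : KroneckerRep k}
    (hM : IsFilteredBy E M) :
    Function.Bijective (M.pencil α β) ∧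
      ∃ T : M.V₁ →ₗ[k] M.V₁, IsNilpotent T ∧ ∀ x, M.pencil γ δ x = M.pencil α β (T x) := by
  induction hM with
  | zero M h₁ h₂ =>
    refine ⟨⟨Function.injective_of_subsingleton _, fun y => ⟨0, Subsingleton.elim _ _⟩⟩, 0,
      IsNilpotent.zero, fun x => Subsingleton.elim _ _⟩
  | step M' M i p h _ ih =>
    obtain ⟨hM', T', ⟨m, hm⟩, hT'⟩ := ih
    have hb : Function.Bijective (M.pencil α β) := by
      constructor
      · rw [← LinearMap.ker_eq_bot, LinearMap.ker_eq_bot']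
        intro x hx
        have hpx : p.f₁ x = 0 := hbij.1 (by rw [← p.comm_pencil, hx, map_zero, map_zero])
        obtain ⟨y, rfl⟩ := (h.exact₁ x).mp hpx
        have hy : y = 0 := hM'.1 (h.inj₂ (by rw [i.comm_pencil, hx, map_zero, map_zero]))
        rw [hy, map_zero]
      · intro z
        obtain ⟨e, he⟩ := hbij.2 (p.f₂ z)
        obtain ⟨x, rfl⟩ := h.surj₁ e
        have hz : p.f₂ (z - M.pencil α β x) = 0 := by
          rw [map_sub, p.comm_pencil, he, sub_self]
        obtain ⟨w, hw⟩ := (h.exact₂ _).mp hz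
        obtain ⟨y, rfl⟩ := hM'.2 w
        refine ⟨x + i.f₁ y, ?_⟩
        rw [map_add, ← i.comm_pencil, hw]
        abel
    let e := LinearEquiv.ofBijective _ hb
    let T : M.V₁ →ₗ[k] M.V₁ := e.symm.toLinearMap ∘ₗ M.pencil γ δ
    have hT : ∀ x, M.pencil γ δ x = M.pencil α β (T x) := fun x =>
      (e.apply_symm_apply (M.pencil γ δ x)).symm
    -- `T` induces zero on the quotient `E`, so one application lands in the image of `M'`, where
    -- `T` restricts to `T'` and m more applications give zero.
    refine ⟨hb, T, ⟨m + 1, ?_⟩, hT⟩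
    have hTi : ∀ y, T (i.f₁ y) = i.f₁ (T' y) := fun y => hb.1 <| by
      rw [← hT, ← i.comm_pencil, ← i.comm_pencil, hT']
    have hTni : ∀ j y, (T ^ j) (i.f₁ y) = i.f₁ ((T' ^ j) y) := by
      intro j
      induction j with
      | zero => simp
      | succ j ih => intro y; rw [pow_succ, pow_succ, End.mul_apply, End.mul_apply, hTi, ih]
    ext x
    have hx : p.f₁ (T x) = 0 := hbij.1 <| by
      rw [← p.comm_pencil, ← hT, p.comm_pencil, hzero, map_zero, LinearMap.zero_apply]
    obtain ⟨y, hy⟩ := (h.exact₁ _).mp hx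
    rw [pow_succ, End.mul_apply, ← hy, hTni, hm]
    simp

/-- A representation of dimension `(n, n)` in a homogeneous tube is, up to isomorphism and a change
of coordinates in the space of arrows, given by the identity and a nilpotent Jordan block. -/
theorem IsInHomogeneousTube.exists_normalForm {E R : KroneckerRep k} (hE : E.IsIndecomposable)
    (hEdim : E.dimVec = ![1, 1]) (hR : IsInHomogeneousTube E R) {n : ℕ} (hn : 1 ≤ n)
    (hRdim : R.dimVec = ![n, n]) :
    ∃ α β γ δ : k, α * δ - β * γ ≠ 0 ∧
      ∃ (φ₁ : R.V₁ ≃ₗ[k] (Fin n → k)) (φ₂ : R.V₂ ≃ₗ[k] (Fin n → k)),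
        (∀ x, φ₂ (R.pencil α β x) = φ₁ x) ∧
        ∀ x, φ₂ (R.pencil γ δ x) = shift k n (φ₁ x) := by
  obtain ⟨α, β, γ, δ, hdet, hbij, hzero⟩ := hE.exists_pencil hEdim
  refine ⟨α, β, γ, δ, hdet, ?_⟩
  obtain ⟨hb, T, hTn, hT⟩ := hR.2.exists_nilpotent hbij hzero
  have h1 := finrank_V₁ hRdim
  have : FiniteDimensional k R.V₁ := FiniteDimensional.of_finrank_pos (by omega)
  have : Nontrivial R.V₁ := nontrivial_of_finrank_pos (R := k) (by omega)
  let e := LinearEquiv.ofBijective _ hb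
  -- A `T`-stable U yields the subrepresentation (U, PU), P being the invertible member of the
  -- pencil. Complements go to complements, so indecomposability of `R` passes to `T`.
  let S : (U : Submodule k R.V₁) → U ≤ U.comap T → R.Subrep := fun U hU =>
    { W₁ := U
      W₂ := U.map (R.pencil α β)
      a_mem := fun x hx => ((R.forall_mem_iff_pencil hdet (U.map (R.pencil α β)) x).2
        ⟨⟨x, hx, rfl⟩, ⟨T x, hU hx, (hT x).symm⟩⟩).1
      b_mem := fun x hx => ((R.forall_mem_iff_pencil hdet (U.map (R.pencil α β)) x).2
        ⟨⟨x, hx, rfl⟩, ⟨T x, hU hx, (hT x).symm⟩⟩).2 }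
  obtain ⟨φ, hφ⟩ := exists_equiv_shift_of_isNilpotent h1 T hTn fun U W hUW hU hW =>
    (hR.1.2 (S U hU) (S W hW) hUW
      (hUW.map (Submodule.orderIsoMapComap e))).imp And.left And.left
  refine ⟨φ, e.symm.trans φ, fun x => ?_, fun x => ?_⟩
  · exact congrArg φ (e.symm_apply_apply x)
  · rw [hT, ← hφ]
    exact congrArg φ (e.symm_apply_apply (T x))

/-- An indecomposable is filtered by itself. -/
lemma isFilteredBy_self (E : KroneckerRep k) : IsFilteredBy E E := by
  let Z : KroneckerRep k := { V₁ := PUnit, V₂ := PUnit, a := 0, b := 0 }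
  refine .step Z E ⟨0, 0, by simp, by simp⟩ ⟨LinearMap.id, LinearMap.id, by simp, by simp⟩ ?_
    (.zero Z (inferInstanceAs (Subsingleton PUnit)) (inferInstanceAs (Subsingleton PUnit)))
  exact
    { inj₁ := fun (x y : PUnit) _ => Subsingleton.elim x y
      inj₂ := fun (x y : PUnit) _ => Subsingleton.elim x y
      exact₁ := fun x => ⟨fun h => ⟨PUnit.unit, h.symm⟩, by rintro ⟨y, rfl⟩; rfl⟩
      exact₂ := fun x => ⟨fun h => ⟨PUnit.unit, h.symm⟩, by rintro ⟨y, rfl⟩; rfl⟩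
      surj₁ := Function.surjective_id
      surj₂ := Function.surjective_id }

end KroneckerRep

/-! ### The recursions specialised to shifts -/

section ShiftSum

variable {k : Type*} [Field k]

lemma stablePairs_of_subsingleton {V : Type*} [AddCommGroup V] [Module k V] [Finite V]
    [Subsingleton V] (T : V →ₗ[k] V) : stablePairs T = {(⊥, ⊥)} := by
  ext p
  rw [mem_stablePairs, Finset.mem_singleton]
  exact ⟨fun _ => Subsingleton.elim _ _, by rintro rfl; simp⟩

variable [Finite k] {G : Type*} [AddCommGroup G] {A : Type*} [CommRing A] [Module A G]

lemma pairSum_shift_zero (ψ : ℤ → ℤ → G) : pairSum (shift k 0) ψ = ψ 0 0 := by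
  simp [pairSum, stablePairs_of_subsingleton]

lemma injPairSum_shift_zero (ψ : ℤ → ℤ → G) : injPairSum (shift k 0) ψ = ψ 0 0 := by
  simp [injPairSum, stablePairs_of_subsingleton]

lemma pairSum_shift_succ (n : ℕ) (ψ : ℤ → ℤ → G) :
    pairSum (shift k (n + 1)) ψ =
      (pairSum (shift k n) fun e f => ψ (e + 1) (f + 1)) + injPairSum (shift k (n + 1)) ψ := by
  rw [shift_succ]
  exact pairSum_eq_add (tailMap_surjective n) (padMap_injective n)
    (by simp) (ker_tailMap n) ψ

lemma injPairSum_shift_succ (v : Aˣ) (hv : (v : A) ^ 2 = (Nat.card k : A)) (n : ℕ)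
    (ψ : ℤ → ℤ → G) :
    injPairSum (shift k (n + 1)) ψ =
      (pairSum (shift k n) fun e f => ((v ^ (2 * e) : Aˣ) : A) • ψ e (f + 1)) +
      injPairSum (shift k n) fun e f => ((v ^ (2 * (f - e)) : Aˣ) : A) • ψ e f := by
  rw [shift_succ]
  exact injPairSum_eq_add (tailMap_surjective n) (padMap_injective n)
    (by simp) (ker_tailMap n) v hv ψ

end ShiftSum

/-! ### Chebyshev recursion and cluster characters -/

namespace KroneckerRep

open Module QuantumTorus

variable {k : Type*} [Field k] {A : Type*} [CommRing A]

/-- The contribution to the cluster character of a representation of dimension `(n, n)` of a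
subrepresentation of dimension `(e, f)`. -/
noncomputable def charTerm (v : Aˣ) (n e f : ℤ) : QuantumTorus lam v :=
  monomial lam v ![n - 2 * f, 2 * e - n, n - e, n - f]
    ((v ^ (-((f - e) * (n - (f - e)))) : Aˣ) : A)

lemma smul_monomial (v : Aˣ) (a b : A) (g : Fin 4 → ℤ) :
    a • monomial lam v g b = monomial lam v g (a * b) :=
  Finsupp.smul_single' a g b

lemma form_lam (e f : Fin 4 → ℤ) : form lam e f =
    -(e 0 * f 2) - e 1 * f 3 + e 2 * (f 0 - 2 * f 3) + e 3 * (f 1 + 2 * f 2) := by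
  simp [form, lam, dotProduct, Matrix.mulVec, Fin.sum_univ_four]
  ring

/-- The Chebyshev recursion, on the level of the terms of the cluster characters. -/
lemma charTerm_mul (v : Aˣ) (n e f : ℤ) :
    charTerm v (n + 1) e f * (charTerm v 1 1 1 + charTerm v 1 0 1 + charTerm v 1 0 0) =
      charTerm v (n + 2) (e + 1) (f + 1) +
      ((v ^ (2 * e) : Aˣ) : A) • charTerm v (n + 2) e (f + 1) +
      ((v ^ (2 * (f - e)) : Aˣ) : A) • charTerm v (n + 2) e f := by
  rw [mul_add, mul_add]
  simp only [charTerm, monomial_mul_monomial, smul_monomial, ← Units.val_mul, ← zpow_add, form_lam]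
  congr 1
  · congr 1
    · congr 1
      · ext i; fin_cases i <;> simp <;> ring
      · congr 2; simp; ring
    · congr 1
      · ext i; fin_cases i <;> simp <;> ring
      · congr 2; simp; ring
  · congr 1
    · ext i; fin_cases i <;> simp <;> ring
    · congr 2; simp; ring

/-- The factor q^(f-e) is unchanged when e and f both increase by one, so this is the weight of the
third summand of `charTerm_mul` evaluated on the pairs with κ in U. -/
lemma X_mul_charTerm (v : Aˣ) (n e f : ℤ) :
    QuantumTorus.X lam v ![0, 0, 1, 1] * charTerm v n e f =
      ((v ^ (2 * (f - e)) : Aˣ) : A) • charTerm v (n + 2) (e + 1) (f + 1) := by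
  simp only [QuantumTorus.X, charTerm, monomial_mul_monomial, smul_monomial, one_mul,
    ← Units.val_mul, ← zpow_add, form_lam]
  congr 1
  · ext i; fin_cases i <;> simp <;> ring
  · congr 2; simp; ring

/-- The Chebyshev polynomials in the character of the mouth of a homogeneous tube are the counts of
stable pairs for the nilpotent shifts. -/
theorem chebyshevS_eq_pairSum [Finite k] (v : Aˣ) (hv : (v : A) ^ 2 = (Nat.card k : A)) (n : ℕ) :
    chebyshevS (pairSum (shift k 1) (charTerm v 1)) n = pairSum (shift k n) (charTerm v n) := by
  have hδ : pairSum (shift k 1) (charTerm v 1) =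
      charTerm v 1 1 1 + charTerm v 1 0 1 + charTerm v 1 0 0 := by
    rw [pairSum_shift_succ, injPairSum_shift_succ v hv, pairSum_shift_zero, pairSum_shift_zero,
      injPairSum_shift_zero]
    simp [add_assoc]
  induction n using Nat.twoStepInduction with
  | zero =>
    rw [pairSum_shift_zero, chebyshevS, one_def, charTerm]
    congr 1
    · ext i; fin_cases i <;> simp
    · simp
  | one => rw [chebyshevS, Nat.cast_one]
  | more n ih0 ih1 =>
    -- Applied to the reweighted terms of level n+2, this turns the sum over injective pairs into a
    -- difference of two full sums; the one at level n is the subtracted Chebyshev term.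
    have h := pairSum_shift_succ (k := k) n
      fun e f => ((v ^ (2 * (f - e)) : Aˣ) : A) • charTerm v (n + 2) e f
    rw [chebyshevS, ih0, ih1, hδ, pairSum_shift_succ (n + 1), injPairSum_shift_succ v hv]
    push_cast
    rw [← sub_eq_iff_eq_add'.mpr h]
    simp only [pairSum, Finset.sum_mul, Finset.mul_sum, charTerm_mul, X_mul_charTerm,
      Finset.sum_add_distrib, add_sub_add_right_eq_sub]
    abel

/-- The cluster character of a representation isomorphic, up to a change of coordinates in the
space of arrows, to the one given by the identity and `T`. -/
lemma clusterCharacter_eq_pairSum [Finite k] (v : Aˣ) {R : KroneckerRep k} {n : ℕ}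
    {α β γ δ : k} (hdet : α * δ - β * γ ≠ 0) {T : (Fin n → k) →ₗ[k] (Fin n → k)}
    (φ₁ : R.V₁ ≃ₗ[k] (Fin n → k)) (φ₂ : R.V₂ ≃ₗ[k] (Fin n → k))
    (h₁ : ∀ x, φ₂ (R.pencil α β x) = φ₁ x) (h₂ : ∀ x, φ₂ (R.pencil γ δ x) = T (φ₁ x)) :
    R.clusterCharacter v = pairSum T (charTerm v n) := by
  classical
  have hd : R.dimVec = ![n, n] := by
    rw [dimVec, φ₁.finrank_eq, φ₂.finrank_eq, finrank_fin_fun]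
  have hstable : ∀ (W₁ : Submodule k R.V₁) (W₂ : Submodule k R.V₂),
      (W₁.map φ₁.toLinearMap, W₂.map φ₂.toLinearMap) ∈ stablePairs T ↔
        ∀ x ∈ W₁, R.a x ∈ W₂ ∧ R.b x ∈ W₂ := by
    intro W₁ W₂
    have hm : ∀ y, φ₂ y ∈ W₂.map φ₂.toLinearMap ↔ y ∈ W₂ := fun y =>
      ⟨by rintro ⟨z, hz, hzy⟩; rwa [← φ₂.injective hzy], fun hy => ⟨y, hy, rfl⟩⟩
    simp only [mem_stablePairs, R.forall_mem_iff_pencil hdet]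
    simp only [← hm, h₁, h₂]
    constructor
    · rintro ⟨h, h'⟩ x hx
      exact ⟨h ⟨x, hx, rfl⟩, h' ⟨φ₁ x, ⟨x, hx, rfl⟩, rfl⟩⟩
    · intro h
      refine ⟨?_, ?_⟩
      · rintro _ ⟨x, hx, rfl⟩
        exact (h x hx).1
      · rintro _ ⟨_, ⟨x, hx, rfl⟩, rfl⟩
        exact (h x hx).2
  rw [clusterCharacter, pairSum,
    ← Finset.sum_fiberwise_of_maps_to 
      (g := fun p : Submodule k (Fin n → k) × Submodule k (Fin n → k) =>
        ![finrank k p.1, finrank k p.2])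
    (t := Finset.Icc 0 R.dimVec)]
  · refine Finset.sum_congr rfl fun e _ => ?_
    have hcard : ((R.Gr e).ncard : ℕ) =
        Finset.card {p ∈ stablePairs T | ![finrank k p.1, finrank k p.2] = e} := by
      rw [← Set.ncard_coe_finset]
      refine Set.ncard_congr
        (fun U _ => (U.W₁.map φ₁.toLinearMap, U.W₂.map φ₂.toLinearMap)) ?_ ?_ ?_
      · rintro U rfl
        simp only [Finset.coe_filter, Set.mem_ofPred_eq]
        refine ⟨(hstable _ _).2 fun x hx => ⟨U.a_mem x hx, U.b_mem x hx⟩, ?_⟩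
        rw [φ₁.finrank_map_eq, φ₂.finrank_map_eq]; rfl
      · rintro ⟨U₁, U₂, _, _⟩ ⟨W₁, W₂, _, _⟩ _ _ h
        have h1 := Submodule.map_injective_of_injective φ₁.injective (congrArg Prod.fst h)
        have h2 := Submodule.map_injective_of_injective φ₂.injective (congrArg Prod.snd h)
        simp only at h1 h2
        subst h1 h2
        rfl
      · rintro ⟨U, W⟩ hp
        simp only [Finset.coe_filter, Set.mem_ofPred_eq] at hp
        obtain ⟨hp, rfl⟩ := hp
        have hU := Submodule.map_comap_eq_of_surjective φ₁.surjective U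
        have hW := Submodule.map_comap_eq_of_surjective φ₂.surjective W
        rw [← hU, ← hW] at hp
        have hs := (hstable _ _).1 hp
        refine ⟨⟨U.comap φ₁.toLinearMap, W.comap φ₂.toLinearMap, fun x hx => (hs x hx).1,
          fun x hx => (hs x hx).2⟩, ?_, Prod.ext hU hW⟩
        change ![_, _] = ![_, _]
        rw [← φ₁.finrank_map_eq, ← φ₂.finrank_map_eq]
        congr 1
        · exact congrArg (fun U : Submodule k _ => finrank k U) hU
        · exact congrArg (fun U : Submodule k _ => ![finrank k U]) hW
    rw [Finset.sum_congr rfl (g := fun _ => charTerm v n (e 0) (e 1)), Finset.sum_const, ← hcard]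
    · rw [hd, ← Nat.cast_smul_eq_nsmul A, mul_smul, charTerm, QuantumTorus.X, smul_monomial,
        mul_one]
      congr 2
      · ext i
        fin_cases i <;>
          simp [matB, matI, matR, matR', dotProduct, Fin.sum_univ_two] <;> ring
      -- For dimension vector (n, n) the Euler form of (e, f) with its complement is (f - e)(n - (f
      -- - e)).
      · congr 2
        simp [eulerForm]
        ring
    · intro p hp
      rw [Finset.mem_filter] at hp
      rw [← hp.2]
      rfl
  · intro p _
    rw [Finset.mem_Icc, hd]
    refine ⟨fun _ => Nat.zero_le _, fun i => ?_⟩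
    have h := fun U : Submodule k (Fin n → k) => U.finrank_le
    simp only [finrank_fin_fun] at h
    fin_cases i
    · exact h p.1
    · exact h p.2

end KroneckerRep

theorem proposition3p4 {k : Type*} [Field k] [Finite k]
    {A : Type*} [CommRing A] (v : Aˣ) (hv : (v : A) ^ 2 = (Nat.card k : A))
    -- `L` is any indecomposable of dimension `(1,1)`; `X_δ` is its character
    (L : KroneckerRep k) (hL : L.IsIndecomposable) (hLdim : L.dimVec = ![1, 1])
    -- `E` is the mouth of the tube, and `R` is the module `R(n)` in it
    (E : KroneckerRep k) (hE : E.IsIndecomposable) (hEdim : E.dimVec = ![1, 1])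
    (n : ℕ) (hn : 1 ≤ n)
    (R : KroneckerRep k) (hR : KroneckerRep.IsInHomogeneousTube E R) (hRdim : R.dimVec = ![n, n]) :
    KroneckerRep.chebyshevS (L.clusterCharacter v) n = R.clusterCharacter v := by
  obtain ⟨_, _, _, _, hdet, φ₁, φ₂, h₁, h₂⟩ := hR.exists_normalForm hE hEdim hn hRdim
  -- `L` is the first member of the tube with mouth `L`, so the normal form with n = 1 applies; its
  -- character is then the same for every choice of `L`.
  obtain ⟨_, _, _, _, hdetL, χ₁, χ₂, hL₁, hL₂⟩ := KroneckerRep.IsInHomogeneousTube.exists_normalForm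
    hL hLdim ⟨hL, L.isFilteredBy_self⟩ le_rfl hLdim
  rw [KroneckerRep.clusterCharacter_eq_pairSum v hdet φ₁ φ₂ h₁ h₂,
    KroneckerRep.clusterCharacter_eq_pairSum v hdetL χ₁ χ₂ hL₁ hL₂, Nat.cast_one,
    KroneckerRep.chebyshevS_eq_pairSum v hv]
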